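/- Let $(V,E)$ be a finite directed graph with propagation probabilities $p_{(u,v)}\in[0,1]$ on its edges. There are $k+1$ cascades: a rumor $C_r$ with a fixed seed set $a_r\subseteq V$, and positive cascades $C_1,\dots,C_k$ generated by $k$ agents. The cascades have distinct priorities, and the rumor has the highest one. Given the seed sets, the cascades spread as follows (P2P independent cascade model). At time $0$ every seed node is activated by the cascade of highest priority among those that selected it. At each time step $t\ge 1$, independently over nodes, every active node $u$ that still has out-neighbors which it has not yet tried to activate selects one of them, $v$, uniformly at random (whether or not $v$ is already active), and the attempt succeeds with probability $p_{(u,v)}$. An inactive node that is successfully activated by one or more nodes in this step joins the cascade of highest priority among the cascades of those nodes; an active node never changes its cascade. Agent $i$ has a finite action space $\mathcal A_i\subseteq 2^V$ of admissible seed sets. A strategy of agent $i$ is a probability distribution on $\mathcal A_i$, and a full-strategy $S=(s_1,\dots,s_k)$ consists of one strategy for each agent; the agents draw their seed sets independently. The social utility $\overline\gamma(S)$ is the expected number of nodes that are never activated by the rumor. Let $S(i,s')$ denote $S$ with the strategy of agent $i$ replaced by $s'$, and let $\emptyset$ stand for taking no action (no seed nodes). In the rumor-aware game the private utility of agent $i$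 is $\overline\delta_i(S)=\overline\gamma(S)-\overline\gamma(S(i,\emptyset))$. A full-strategy $S$ is a (mixed) Nash equilibrium if $\overline\delta_i(S)\ge\overline\delta_i(S(i,s_i'))$ for every agent $i$ and every strategy $s_i'$ of agent $i$. Suppose that the full-strategy $S$ is a Nash equilibrium of the rumor-aware game. Then there is a full-strategy that maximizes $\overline\gamma$ over all full-strategies, and for every such maximizer $\Omega$ $$\overline\gamma(S)\ \ge\ \tfrac12\cdot\overline\gamma(\Omega).$$ -/

import Mathlib

open scoped NNReal ENNReal

namespace RumorBlocking

noncomputable section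

/-- A finite directed graph `(V, E)` with a propagation probability for every edge
(the values of `prob` at pairs that are not edges are never used). -/
structure Network (V : Type*) where
  /-- the set of directed edges -/
  edges : Finset (V × V)
  /-- `prob (u, v)` is the probability that an attempt of `u` to activate `v` succeeds -/
  prob : V × V → ℝ≥0
  prob_le_one : ∀ e, prob e ≤ 1

/-- The `k + 1` cascades: `none` is the rumor, `some i` is the positive cascade of agent `i`. -/
abbrev Cascade (k : ℕ) := Option (Fin k)

/-- The data of the rumor blocking game with `k` agents on the node set `V`. -/
structure Game (V : Type*) (k : ℕ) extends Network V where
  /-- the fixed seed set of the rumor -/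
  rumorSeeds : Finset V
  /-- the priorities of the cascades (a larger value is a higher priority) -/
  priority : Cascade k → ℕ
  priority_injective : Function.Injective priority
  rumor_highest : ∀ i : Fin k, priority (some i) < priority none
  /-- the action space of each agent: the seed sets that the agent can select -/
  actions : Fin k → Finset (Finset V)

/-- A toss of a coin that shows `true` with probability `p`. -/
def coin (p : ℝ≥0) (hp : p ≤ 1) : PMF Bool :=
  PMF.ofFintype (fun b => ((if b then p else 1 - p : ℝ≥0) : ℝ≥0∞)) (by
    rw [Fintype.sum_bool, ← ENNReal.coe_add]
    simp [add_tsub_cancel_of_le hp])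

/-- Independent draws, one from each of finitely many distributions. -/
def independent {ι β : Type*} [Fintype ι] [DecidableEq ι] [Fintype β] (q : ι → PMF β) :
    PMF (ι → β) :=
  PMF.ofFintype (fun d => ∏ i, q i (d i)) (by
    rw [← Fintype.prod_sum]
    refine Finset.prod_eq_one fun i _ => ?_
    rw [← tsum_fintype (L := .unconditional β)]
    exact (q i).tsum_coe)

/-- A state of the diffusion: for each node the cascade that has activated it (`none` if the node
is inactive), and the set of the nodes that it has already tried to activate. -/
abbrev State (V : Type*) (k : ℕ) := (V → Option (Cascade k)) × (V → Finset V)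

section Diffusion

variable {V : Type*} [Fintype V] [DecidableEq V] {k : ℕ}

/-- The out-neighbors of `u`. -/
def Network.outNeighbors (N : Network V) (u : V) : Finset V :=
  Finset.univ.filter fun v => (u, v) ∈ N.edges

/-- The out-neighbors of `u` that `u` has not yet tried to activate. -/
def Network.untried (N : Network V) (s : State V k) (u : V) : Finset V :=
  N.outNeighbors u \ s.2 u

/-- What the node `u` does in one time step: an active node with an untried out-neighbor selects
one of these, `v`, uniformly at random and then succeeds with probability `prob (u, v)`; the outcome
is `some (v, success)`. Otherwise `u` does nothing, and the outcome is `none`. -/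
def Network.attempt (N : Network V) (s : State V k) (u : V) : PMF (Option (V × Bool)) :=
  if h : s.1 u ≠ none ∧ (N.untried s u).Nonempty then
    (PMF.uniformOfFinset (N.untried s u) h.2).bind fun v =>
      (coin (N.prob (u, v)) (N.prob_le_one (u, v))).map fun ok => some (v, ok)
  else PMF.pure none

/-- The cascade of the highest priority in a set of cascades (`none` for the empty set). -/
def Game.strongest (G : Game V k) (C : Finset (Cascade k)) : Option (Cascade k) :=
  C.toList.argmax G.priority

/-- The state after a time step in which node `u` makes the attempt `d u`: an active node keeps its
cascade, and an inactive node joins the cascade of the highest priority among those of the nodes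
that have successfully activated it in this step, if any. -/
def Game.update (G : Game V k) (s : State V k) (d : V → Option (V × Bool)) : State V k :=
  (fun v => match s.1 v with
    | some c => some c
    | none => G.strongest
        (Finset.univ.filter fun c => ∃ u, s.1 u = some c ∧ d u = some (v, true)),
   fun u => match d u with
    | some (v, _) => insert v (s.2 u)
    | none => s.2 u)

/-- The law of the state one time step after the state `s`: all nodes act independently. -/
def Game.step (G : Game V k) (s : State V k) : PMF (State V k) :=
  (independent (G.attempt s)).map (G.update s)

/-- The seed set of each cascade when the agents select the seed sets `A`. -/
def Game.seeds (G : Game V k) (A : Fin k → Finset V) : Cascade k → Finset V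
  | none => G.rumorSeeds
  | some i => A i

/-- The state at time `0`: a seed node joins the cascade of the highest priority among those that
have selected it, and nobody has tried to activate anybody. -/
def Game.initial (G : Game V k) (A : Fin k → Finset V) : State V k :=
  (fun v => G.strongest (Finset.univ.filter fun c => v ∈ G.seeds A c), fun _ => ∅)

/-- The law of the state at time `t` of the diffusion process with the positive seed sets `A`. -/
def Game.law (G : Game V k) (A : Fin k → Finset V) : ℕ → PMF (State V k)
  | 0 => PMF.pure (G.initial A)
  | t + 1 => (G.law A t).bind G.step

/-- The number of nodes that are not activated by the rumor in the state `s`. -/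
def notRumorCount (s : State V k) : ℕ :=
  (Finset.univ.filter fun v => s.1 v ≠ some none).card

/-- The expected number of nodes that are never activated by the rumor when the agents select the
seed sets `A`. The process has stopped at time `|E|` at the latest, since until then at least one
edge is used in every step; see `Game.law_stationary`. -/
def Game.gamma (G : Game V k) (A : Fin k → Finset V) : ℝ :=
  ∑ s : State V k, (G.law A G.edges.card s).toReal * (notRumorCount s : ℝ)

/-- The social utility: the expected number of nodes that are never activated by the rumor when
agent `i` draws its seed set from the distribution `S i`, independently of the other agents. -/
def Game.socialUtility (G : Game V k) (S : Fin k → PMF (Finset V)) : ℝ :=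
  ∑ A : Fin k → Finset V, (independent S A).toReal * G.gamma A

/-- The strategy of an agent that takes no action, and so has no seed. -/
def emptyStrategy : PMF (Finset V) := PMF.pure ∅

/-- The private utility of agent `i` in the rumor-aware game: the social utility minus the social
utility when agent `i` takes no action. -/
def Game.privateUtility (G : Game V k) (i : Fin k) (S : Fin k → PMF (Finset V)) : ℝ :=
  G.socialUtility S - G.socialUtility (Function.update S i emptyStrategy)

/-- `s` is a strategy of agent `i`: a distribution over the actions of agent `i`. -/
def Game.IsStrategy (G : Game V k) (i : Fin k) (s : PMF (Finset V)) : Prop :=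
  ∀ a ∈ s.support, a ∈ G.actions i

/-- `S` is a full-strategy: `S i` is a strategy of agent `i` for every `i`. -/
def Game.IsFullStrategy (G : Game V k) (S : Fin k → PMF (Finset V)) : Prop :=
  ∀ i, G.IsStrategy i (S i)

/-- The full-strategy `S` is a (mixed) Nash equilibrium of the rumor-aware game: no agent gains
private utility by changing its own strategy. -/
def Game.IsNashEquilibrium (G : Game V k) (S : Fin k → PMF (Finset V)) : Prop :=
  G.IsFullStrategy S ∧ ∀ i, ∀ s, G.IsStrategy i s →
    G.privateUtility i (Function.update S i s) ≤ G.privateUtility i S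

/-- The full-strategy `S` maximizes the social utility over all full-strategies. -/
def Game.IsSociallyOptimal (G : Game V k) (S : Fin k → PMF (Finset V)) : Prop :=
  G.IsFullStrategy S ∧ ∀ T, G.IsFullStrategy T → G.socialUtility T ≤ G.socialUtility S

end Diffusion

/-! The process has stopped at time `|E|`. -/

section Stationary

variable {V : Type*} [Fintype V] [DecidableEq V] {k : ℕ}

/-- A draw that has positive probability uses an untried edge or does nothing. -/
theorem Network.mem_support_attempt (N : Network V) (s : State V k) (u : V)
    {x : Option (V × Bool)} (hx : x ∈ (N.attempt s u).support) :
    (x = none ∧ ¬ (s.1 u ≠ none ∧ (N.untried s u).Nonempty)) ∨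
      ((s.1 u ≠ none ∧ (N.untried s u).Nonempty) ∧
        ∃ v ∈ N.untried s u, ∃ b, x = some (v, b)) := by
  unfold Network.attempt at hx
  split_ifs at hx with h
  · right
    refine ⟨h, ?_⟩
    rw [PMF.mem_support_bind_iff] at hx
    obtain ⟨v, hv, hx⟩ := hx
    rw [PMF.mem_support_uniformOfFinset_iff] at hv
    rw [PMF.mem_support_map_iff] at hx
    obtain ⟨b, _, rfl⟩ := hx
    exact ⟨v, hv, b, rfl⟩
  · left
    rw [PMF.mem_support_pure_iff] at hx
    exact ⟨hx, h⟩

theorem mem_support_independent {ι β : Type*} [Fintype ι] [DecidableEq ι] [Fintype β]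
    (q : ι → PMF β) {d : ι → β} (hd : d ∈ (independent q).support) (i : ι) :
    d i ∈ (q i).support := by
  rw [PMF.mem_support_iff] at hd ⊢
  intro h
  exact hd (by
    simp only [independent, PMF.ofFintype_apply]
    exact Finset.prod_eq_zero (Finset.mem_univ i) h)

/-- No active node has an untried out-neighbor. -/
def Network.Stopped (N : Network V) (s : State V k) : Prop :=
  ∀ u, ¬ (s.1 u ≠ none ∧ (N.untried s u).Nonempty)

theorem Game.step_of_stopped (G : Game V k) (s : State V k) (hs : G.Stopped s) :
    G.step s = PMF.pure s := by
  have key : ∀ t ∈ (G.step s).support, t = s := by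
    intro t ht
    unfold Game.step at ht
    rw [PMF.mem_support_map_iff] at ht
    obtain ⟨d, hd, rfl⟩ := ht
    have hd0 : ∀ u, d u = none := by
      intro u
      rcases G.mem_support_attempt s u (mem_support_independent _ hd u) with h | h
      · exact h.1
      · exact absurd h.1 (hs u)
    refine Prod.ext (funext fun v => ?_) (funext fun u => ?_)
    · cases hv : s.1 v with
      | some c => simp [Game.update, hv]
      | none => simp [Game.update, hv, hd0, Game.strongest]
    · simp [Game.update, hd0]
  have hsupp : (G.step s).support = {s} := by
    refine Set.eq_singleton_iff_nonempty_unique_mem.2 ⟨(G.step s).support_nonempty, key⟩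
  ext t
  rw [PMF.pure_apply]
  split_ifs with h
  · subst h
    exact (PMF.apply_eq_one_iff _ _).2 hsupp
  · exact (PMF.apply_eq_zero_iff _ _).2 (by rw [hsupp]; exact h)

theorem Game.support_law (G : Game V k) (A : Fin k → Finset V) (t : ℕ) :
    ∀ s ∈ (G.law A t).support, (∀ u, s.2 u ⊆ G.outNeighbors u) ∧
      (G.Stopped s ∨ t ≤ ∑ u, (s.2 u).card) := by
  induction t with
  | zero =>
    intro s hs
    rw [Game.law, PMF.mem_support_pure_iff] at hs
    subst hs
    exact ⟨fun u => by simp [Game.initial], Or.inr (Nat.zero_le _)⟩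
  | succ t ih =>
    intro s' hs'
    rw [Game.law, PMF.mem_support_bind_iff] at hs'
    obtain ⟨s, hs, hs'⟩ := hs'
    obtain ⟨hsub, hor⟩ := ih s hs
    by_cases hst : G.Stopped s
    · rw [G.step_of_stopped s hst, PMF.mem_support_pure_iff] at hs'
      subst hs'
      exact ⟨hsub, Or.inl hst⟩
    · have hle := hor.resolve_left hst
      unfold Game.step at hs'
      rw [PMF.mem_support_map_iff] at hs'
      obtain ⟨d, hd, rfl⟩ := hs'
      have hdu := fun u => G.mem_support_attempt s u (mem_support_independent _ hd u)
      have hmono : ∀ u, s.2 u ⊆ (G.update s d).2 u := by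
        intro u
        simp only [Game.update]
        split
        · exact Finset.subset_insert _ _
        · exact subset_rfl
      refine ⟨fun u => ?_, Or.inr ?_⟩
      · rcases hdu u with ⟨h, _⟩ | ⟨_, v, hv, b, h⟩
        · simpa [Game.update, h] using hsub u
        · simp only [Game.update, h]
          exact Finset.insert_subset (Finset.mem_sdiff.1 hv).1 (hsub u)
      · unfold Network.Stopped at hst
        push Not at hst
        obtain ⟨u, hu⟩ := hst
        refine lt_of_le_of_lt hle (Finset.sum_lt_sum
          (fun u _ => Finset.card_le_card (hmono u)) ⟨u, Finset.mem_univ u, ?_⟩)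
        rcases hdu u with ⟨_, h⟩ | ⟨_, v, hv, b, h⟩
        · exact absurd hu h
        · simp only [Game.update, h]
          rw [Finset.card_insert_of_notMem (Finset.mem_sdiff.1 hv).2]
          exact Nat.lt_succ_self _

theorem Network.sum_card_outNeighbors (N : Network V) :
    ∑ u, (N.outNeighbors u).card = N.edges.card := by
  rw [Finset.card_eq_sum_card_fiberwise (f := Prod.fst) (t := Finset.univ) (by simp)]
  refine Finset.sum_congr rfl fun u _ => ?_
  refine Finset.card_bij' (fun v _ => (u, v)) (fun e _ => e.2) ?_ ?_ ?_ ?_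
  · intro v hv; simpa [Network.outNeighbors] using hv
  · rintro ⟨a, b⟩ h
    simp only [Finset.mem_filter] at h
    obtain ⟨h1, rfl⟩ := h
    simpa [Network.outNeighbors] using h1
  · intro v _; rfl
  · rintro ⟨a, b⟩ h
    simp only [Finset.mem_filter] at h
    obtain ⟨_, rfl⟩ := h
    rfl

theorem Game.stopped_law (G : Game V k) (A : Fin k → Finset V) :
    ∀ s ∈ (G.law A G.edges.card).support, G.Stopped s := by
  intro s hs
  obtain ⟨hsub, h | h⟩ := G.support_law A _ s hs
  · exact h
  · rw [← G.sum_card_outNeighbors] at h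
    have hall : ∀ u, (s.2 u).card = (G.outNeighbors u).card := by
      have hle : ∀ u ∈ Finset.univ, (s.2 u).card ≤ (G.outNeighbors u).card :=
        fun u _ => Finset.card_le_card (hsub u)
      have heq := le_antisymm (Finset.sum_le_sum hle) h
      intro u
      exact (Finset.sum_eq_sum_iff_of_le hle).1 heq u (Finset.mem_univ u)
    rintro u ⟨_, hne⟩
    have he : s.2 u = G.outNeighbors u := Finset.eq_of_subset_of_card_le (hsub u) (hall u).ge
    simp [Network.untried, he] at hne

/-- From time `|E|` on the law of the state does not change any more. -/
theorem Game.law_stationary (G : Game V k) (A : Fin k → Finset V) (n : ℕ) :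
    G.law A (G.edges.card + n) = G.law A G.edges.card := by
  induction n with
  | zero => rfl
  | succ n ih =>
    rw [← add_assoc, Game.law, ih]
    ext t
    rw [PMF.bind_apply]
    conv_rhs => rw [← PMF.bind_pure (G.law A G.edges.card), PMF.bind_apply]
    refine tsum_congr fun s => ?_
    by_cases hs : s ∈ (G.law A G.edges.card).support
    · rw [G.step_of_stopped s (G.stopped_law A s hs)]
    · rw [(PMF.apply_eq_zero_iff _ _).2 hs, zero_mul, zero_mul]

end Stationary

end

end RumorBlocking

namespace RumorBlocking

noncomputable section

/-! ### Product distributions: two-stage draws and resampling. -/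

section Independent

variable {ι α β : Type*} [Fintype ι] [DecidableEq ι] [Fintype α] [Fintype β]

/-! By deferred decisions, all randomness can be drawn beforehand as a deck: for each node `u` and
each set `T` already tried by `u`, the next attempt of `u`. An entry is consulted at most once, so
running the deterministic diffusion on a random deck gives the original law
(`Game.law_eq_map_deckLaw`).

For a fixed deck, what `u` does `j` steps after its activation depends neither on its cascade nor on
other nodes. Propagation thus becomes reachability with fixed delays. Since the rumor wins ties, `v`
is saved exactly when a positive seed reaches it strictly before the first arrival of the rumor, or
when the rumor never arrives (`Game.exists_coverage`). So the event that `v` is saved is a coverage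
condition on the union of the positive seed sets.

Coverage functions are monotone and submodular, which gives two inequalities for each deck and node.
They survive summing over nodes and averaging over decks and mixed strategies. With `U` the social
utility and `S₋ᵢ` the profile in which agent `i` abstains, they read `U(Ω) + ∑ U(S₋ᵢ) ≤ U(S) + ∑
U(S(i, Ωᵢ))` and `∑ U(S) ≤ U(S) + ∑ U(S₋ᵢ)`. The term subtracted in a private utility does not
depend on the agent's own strategy, so equilibrium gives `U(S(i, Ωᵢ)) ≤ U(S)`. Chaining the three
yields `U(Ω) ≤ 2 U(S)`. -/

theorem independent_apply (q : ι → PMF β) (d : ι → β) :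
    independent q d = ∏ i, q i (d i) := rfl

/-- Expanding a product of sums shows that two-stage draws may be made coordinate by coordinate.
Mapping, resampling and updating below are instances with suitable kernels. -/
theorem independent_bind (a : ι → PMF α) (K : ι → α → PMF β) :
    independent (fun i => (a i).bind (K i)) =
      (independent a).bind fun d => independent fun i => K i (d i) := by
  ext y
  simp only [independent_apply, PMF.bind_apply, tsum_fintype]
  rw [Fintype.prod_sum]
  exact Finset.sum_congr rfl fun d _ => Finset.prod_mul_distrib

theorem independent_pure (x : ι → β) :
    independent (fun i => PMF.pure (x i)) = PMF.pure x := by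
  classical
  ext y
  simp only [independent_apply, PMF.pure_apply]
  split_ifs with h
  · subst h; simp
  · obtain ⟨i, hi⟩ := Function.ne_iff.1 h
    exact Finset.prod_eq_zero (Finset.mem_univ i) (by simp [hi])

theorem independent_map (a : ι → PMF α) (f : ι → α → β) :
    independent (fun i => (a i).map (f i)) = (independent a).map fun d i => f i (d i) := by
  have h := independent_bind a fun i x => PMF.pure (f i x)
  simp only [independent_pure] at h
  exact h

/-- The coordinates of independent draws have the given distributions. -/
theorem map_eval_independent (q : ι → PMF β) (i : ι) :
    (independent q).map (fun d => d i) = q i := by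
  classical
  ext x
  simp only [PMF.map_apply, independent_apply, tsum_fintype]
  -- The indicator is absorbed into factor `i`, so that the sum over `d` still factorizes.
  have h : ∀ d : ι → β, (if x = d i then ∏ j, q j (d j) else 0) =
      ∏ j, (if j = i then (if x = d j then q j (d j) else 0) else q j (d j)) := by
    intro d
    split_ifs with hx
    · refine Finset.prod_congr rfl fun j _ => ?_
      split_ifs with h1 h2
      · rfl
      · subst h1; exact absurd hx h2
      · rfl
    · exact (Finset.prod_eq_zero (Finset.mem_univ i) (by simp [hx])).symm
  simp only [h]
  rw [← Fintype.prod_sum fun j y => if j = i then (if x = y then q j y else 0) else q j y]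
  rw [Finset.prod_eq_single i]
  · simp
  · intro j _ hj
    simp only [hj, if_false]
    rw [← tsum_fintype (L := .unconditional β)]
    exact (q j).tsum_coe
  · simp

/-- Drawing some of the coordinates again does not change the law of independent draws. -/
theorem independent_resample (q : ι → PMF β) (P : ι → Prop) [DecidablePred P] :
    ((independent q).bind fun d => (independent q).map fun e i => if P i then d i else e i) =
      independent q := by
  have h1 : ∀ d : ι → β, ((independent q).map fun e i => if P i then d i else e i) =
      independent fun i => if P i then PMF.pure (d i) else q i := by
    intro d
    rw [← independent_map q fun i y => if P i then d i else y]
    congr 1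
    funext i
    split_ifs
    · exact PMF.map_const _ _
    · exact PMF.map_id _
  simp only [h1]
  rw [← independent_bind q fun i x => if P i then PMF.pure x else q i]
  congr 1
  funext i
  split_ifs
  · exact PMF.bind_pure _
  · exact PMF.bind_const _ _

/-- Lets one pair of independent profiles serve the unilateral deviations of all agents at once. -/
theorem map_update_independent (q r : ι → PMF β) (i : ι) :
    ((independent q).bind fun d => (independent r).map fun e => Function.update d i (e i)) =
      independent (Function.update q i (r i)) := by
  have h1 : ∀ d : ι → β, ((independent r).map fun e => Function.update d i (e i)) =
      independent fun j => if j = i then r j else PMF.pure (d j) := by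
    intro d
    have h2 : (fun e : ι → β => Function.update d i (e i)) =
        fun e j => if j = i then e j else d j := by
      funext e j
      by_cases h : j = i
      · subst h; simp
      · simp [h]
    rw [h2, ← independent_map r fun j y => if j = i then y else d j]
    congr 1
    funext j
    split_ifs
    · exact PMF.map_id _
    · exact PMF.map_const _ _
  simp only [h1]
  rw [← independent_bind q fun j x => if j = i then r j else PMF.pure x]
  congr 1
  funext j
  by_cases h : j = i
  · subst h; simp
  · simp [h]

end Independent

theorem bind_congr_support {α β : Type*} (p : PMF α) {f g : α → PMF β}
    (h : ∀ a ∈ p.support, f a = g a) : p.bind f = p.bind g := by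
  ext b
  simp only [PMF.bind_apply]
  refine tsum_congr fun a => ?_
  by_cases ha : a ∈ p.support
  · rw [h a ha]
  · rw [(PMF.apply_eq_zero_iff _ _).2 ha, zero_mul, zero_mul]

/-! ### Finite expectations. -/

section Expectation

variable {α β : Type*} [Fintype α] [Fintype β]

/-- The expectation of a real function on a finite type. -/
def expect (p : PMF α) (f : α → ℝ) : ℝ := ∑ a, (p a).toReal * f a

theorem expect_bind (p : PMF α) (q : α → PMF β) (f : β → ℝ) :
    expect (p.bind q) f = expect p fun a => expect (q a) f := by
  simp only [expect, PMF.bind_apply, tsum_fintype, Finset.mul_sum]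
  rw [Finset.sum_comm]
  refine Finset.sum_congr rfl fun b _ => ?_
  rw [ENNReal.toReal_sum fun a _ => ENNReal.mul_ne_top (p.apply_ne_top a) ((q a).apply_ne_top b),
    Finset.sum_mul]
  simp only [ENNReal.toReal_mul, mul_assoc]

theorem expect_pure (a : α) (f : α → ℝ) : expect (PMF.pure a) f = f a := by
  classical
  simp only [expect, PMF.pure_apply]
  rw [Finset.sum_eq_single a] <;> simp +contextual

theorem expect_map (p : PMF α) (g : α → β) (f : β → ℝ) :
    expect (p.map g) f = expect p fun a => f (g a) := by
  rw [PMF.map, expect_bind]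
  simp only [Function.comp_apply, expect_pure]

theorem expect_mono_support (p : PMF α) {f g : α → ℝ} (h : ∀ a ∈ p.support, f a ≤ g a) :
    expect p f ≤ expect p g := by
  refine Finset.sum_le_sum fun a _ => ?_
  by_cases ha : a ∈ p.support
  · exact mul_le_mul_of_nonneg_left (h a ha) ENNReal.toReal_nonneg
  · simp [(PMF.apply_eq_zero_iff _ _).2 ha]

theorem expect_mono (p : PMF α) {f g : α → ℝ} (h : ∀ a, f a ≤ g a) : expect p f ≤ expect p g :=
  expect_mono_support p fun a _ => h a

theorem expect_add (p : PMF α) (f g : α → ℝ) :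
    expect p (fun a => f a + g a) = expect p f + expect p g := by
  simp only [expect, mul_add, Finset.sum_add_distrib]

theorem expect_sum {κ : Type*} (p : PMF α) (t : Finset κ) (f : κ → α → ℝ) :
    expect p (fun a => ∑ i ∈ t, f i a) = ∑ i ∈ t, expect p (f i) := by
  simp only [expect, Finset.mul_sum]
  exact Finset.sum_comm

theorem expect_const (p : PMF α) (c : ℝ) : expect p (fun _ => c) = c := by
  rw [expect, ← Finset.sum_mul, ← ENNReal.toReal_sum fun a _ => p.apply_ne_top a,
    ← tsum_fintype (L := .unconditional α), p.tsum_coe, ENNReal.toReal_one, one_mul]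

end Expectation

/-! ### Deferred decisions: the diffusion driven by a deck drawn in advance. -/

section Decks

variable {V : Type*} [Fintype V] [DecidableEq V] {k : ℕ}

/-- A deck tells, for each node and each set of out-neighbors that the node has already tried,
which attempt the node makes next. -/
abbrev Deck (V : Type*) := V → Finset V → Option (V × Bool)

/-- The law of the attempt of an active node `u` that has already tried the nodes in `T`. -/
def Network.attemptAfter (N : Network V) (u : V) (T : Finset V) : PMF (Option (V × Bool)) :=
  if h : (N.outNeighbors u \ T).Nonempty then
    (PMF.uniformOfFinset (N.outNeighbors u \ T) h).bind fun v =>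
      (coin (N.prob (u, v)) (N.prob_le_one (u, v))).map fun ok => some (v, ok)
  else PMF.pure none

/-- The law of a deck whose entries are drawn independently. -/
def Network.deckLaw (N : Network V) : PMF (Deck V) :=
  independent fun u => independent (N.attemptAfter u)

/-- The entry of a deck that the node `u` uses after it has tried the nodes in `T`. -/
def Network.entry (N : Network V) (w : Deck V) (u : V) (T : Finset V) : Option (V × Bool) :=
  if (N.outNeighbors u \ T).Nonempty then w u T else none

/-- The attempt of `u` in the state `s` according to a deck. -/
def Network.draw (N : Network V) (w : Deck V) (s : State V k) (u : V) : Option (V × Bool) :=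
  if s.1 u ≠ none then N.entry w u (s.2 u) else none

/-- A time step of the diffusion according to a deck. -/
def Game.deckStep (G : Game V k) (w : Deck V) (s : State V k) : State V k :=
  G.update s (G.draw w s)

/-- An active node reads a single entry of its row, and the marginal law of that entry is the law of
the attempt. -/
theorem Network.attempt_eq_map (N : Network V) (s : State V k) (u : V) :
    N.attempt s u = (independent (N.attemptAfter u)).map fun f =>
      if s.1 u ≠ none ∧ (N.untried s u).Nonempty then f (s.2 u) else none := by
  by_cases h : s.1 u ≠ none ∧ (N.untried s u).Nonempty
  · simp only [h, ne_eq, not_false_eq_true, and_self, if_true]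
    rw [map_eval_independent]
    unfold Network.attempt Network.attemptAfter
    rw [dif_pos h]
    symm
    exact dif_pos (c := (N.outNeighbors u \ s.2 u).Nonempty) h.2
  · simp only [h, if_false]
    rw [Network.attempt, dif_neg h]
    exact (PMF.map_const _ _).symm

theorem Network.draw_eq (N : Network V) (w : Deck V) (s : State V k) (u : V) :
    N.draw w s u = if s.1 u ≠ none ∧ (N.untried s u).Nonempty then w u (s.2 u) else none := by
  unfold Network.draw Network.entry Network.untried
  split_ifs <;> simp_all

theorem Game.step_eq_map_deckStep (G : Game V k) (s : State V k) :
    G.step s = G.deckLaw.map fun w => G.deckStep w s := by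
  have h : independent (G.attempt s) = G.deckLaw.map fun w => G.draw w s := by
    have h1 : G.attempt s = fun u => (independent (G.attemptAfter u)).map fun f =>
        if s.1 u ≠ none ∧ (G.untried s u).Nonempty then f (s.2 u) else none :=
      funext fun u => G.attempt_eq_map s u
    rw [h1, independent_map (fun u => independent (G.attemptAfter u)) fun u f =>
        if s.1 u ≠ none ∧ (G.untried s u).Nonempty then f (s.2 u) else none]
    unfold Network.deckLaw
    congr 1
    funext w u
    exact (G.draw_eq w s u).symm
  rw [Game.step, h, PMF.map_comp]
  rfl

theorem Game.subset_deckStep_tried (G : Game V k) (w : Deck V) (s : State V k) (u : V) :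
    s.2 u ⊆ (G.deckStep w s).2 u := by
  simp only [Game.deckStep, Game.update]
  split
  · exact Finset.subset_insert _ _
  · exact subset_rfl

/-- The diffusion only uses the deck at sets that contain the already tried nodes. -/
theorem Game.iterate_deckStep_congr (G : Game V k) (w w' : Deck V) (n : ℕ) :
    ∀ s : State V k, (∀ u T, s.2 u ⊆ T → w u T = w' u T) →
      (G.deckStep w)^[n] s = (G.deckStep w')^[n] s := by
  induction n with
  | zero => intro s _; rfl
  | succ n ih =>
    intro s h
    have h1 : G.deckStep w s = G.deckStep w' s := by
      unfold Game.deckStep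
      congr 1
      funext u
      simp only [Network.draw, Network.entry, h u (s.2 u) subset_rfl]
    rw [Function.iterate_succ_apply, Function.iterate_succ_apply, ← h1]
    exact ih _ fun u T hT => h u T ((G.subset_deckStep_tried w s u).trans hT)

/-- Splits a deck into the entries consulted in state `s` and an independent remainder for later
steps. -/
theorem Network.deckLaw_resample (N : Network V) (s : State V k) :
    (N.deckLaw.bind fun w => N.deckLaw.map fun w' u T =>
      if T = s.2 u ∧ s.1 u ≠ none ∧ (N.untried s u).Nonempty then w u T else w' u T) =
      N.deckLaw := by
  unfold Network.deckLaw
  have h1 : ∀ w : Deck V, ((independent fun u => independent (N.attemptAfter u)).map fun w' u T =>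
      if T = s.2 u ∧ s.1 u ≠ none ∧ (N.untried s u).Nonempty then w u T else w' u T) =
      independent fun u => (independent (N.attemptAfter u)).map fun f T =>
        if T = s.2 u ∧ s.1 u ≠ none ∧ (N.untried s u).Nonempty then w u T else f T :=
    fun w => (independent_map (fun u => independent (N.attemptAfter u)) fun u f T =>
      if T = s.2 u ∧ s.1 u ≠ none ∧ (N.untried s u).Nonempty then w u T else f T).symm
  simp only [h1]
  rw [← independent_bind (fun u => independent (N.attemptAfter u)) fun u g =>
    (independent (N.attemptAfter u)).map fun f T =>
        if T = s.2 u ∧ s.1 u ≠ none ∧ (N.untried s u).Nonempty then g T else f T]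
  congr 1
  funext u
  exact independent_resample (N.attemptAfter u)
    fun T => T = s.2 u ∧ s.1 u ≠ none ∧ (N.untried s u).Nonempty

theorem Network.mem_support_deckLaw (N : Network V) {w : Deck V} (hw : w ∈ N.deckLaw.support)
    (u : V) (T : Finset V) (hT : (N.outNeighbors u \ T).Nonempty) :
    ∃ v ∈ N.outNeighbors u \ T, ∃ b, w u T = some (v, b) := by
  have h := mem_support_independent _ (mem_support_independent _ hw u) T
  rw [Network.attemptAfter, dif_pos hT, PMF.mem_support_bind_iff] at h
  obtain ⟨v, hv, hx⟩ := h
  rw [PMF.mem_support_uniformOfFinset_iff] at hv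
  rw [PMF.mem_support_map_iff] at hx
  obtain ⟨b, _, hb⟩ := hx
  exact ⟨v, hv, b, hb.symm⟩

/-- The diffusion may use a fresh deck in the first step. -/
theorem Game.map_iterate_deckStep_succ (G : Game V k) (n : ℕ) (s : State V k) :
    (G.deckLaw.map fun w => (G.deckStep w)^[n + 1] s) =
      (G.step s).bind fun s' => G.deckLaw.map fun w => (G.deckStep w)^[n] s' := by
  rw [G.step_eq_map_deckStep, PMF.bind_map]
  conv_lhs => rw [← G.deckLaw_resample s]
  rw [PMF.map_bind]
  -- The support matters: there a consulted entry names an untried node, so the tried set strictly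
  -- grows and the same entry is never consulted again.
  refine bind_congr_support _ fun w hw => ?_
  rw [PMF.map_comp]
  simp only [Function.comp_apply]
  congr 1
  funext w'
  simp only [Function.comp_apply, Function.iterate_succ_apply]
  set m : Deck V := fun u T =>
    if T = s.2 u ∧ s.1 u ≠ none ∧ (G.untried s u).Nonempty then w u T else w' u T with hm
  have h1 : G.deckStep m s = G.deckStep w s := by
    unfold Game.deckStep
    congr 1
    funext u
    simp only [Network.draw_eq, hm]
    split_ifs with h <;> simp_all
  rw [h1]
  refine G.iterate_deckStep_congr _ _ n _ fun u T hT => ?_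
  simp only [hm]
  rw [if_neg]
  rintro ⟨rfl, hu, hne⟩
  obtain ⟨v, hv, b, hb⟩ := G.mem_support_deckLaw hw u (s.2 u) hne
  refine (Finset.mem_sdiff.1 hv).2 (hT ?_)
  simp [Game.deckStep, Game.update, Network.draw_eq, hu, hne, hb]

/-- Interpolates between random steps and deck steps; the induction converts one random step at a
time, hence the general `n`. -/
theorem Game.law_bind_deckLaw (G : Game V k) (A : Fin k → Finset V) (t : ℕ) :
    ∀ n, ((G.law A t).bind fun s => G.deckLaw.map fun w => (G.deckStep w)^[n] s) =
      G.deckLaw.map fun w => (G.deckStep w)^[t + n] (G.initial A) := by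
  induction t with
  | zero => intro n; rw [Game.law, PMF.pure_bind, Nat.zero_add]
  | succ t ih =>
    intro n
    rw [Game.law, PMF.bind_bind]
    simp only [← G.map_iterate_deckStep_succ]
    rw [ih (n + 1)]
    congr 1
    funext w
    congr 1
    omega

theorem Game.law_eq_map_deckLaw (G : Game V k) (A : Fin k → Finset V) (t : ℕ) :
    G.law A t = G.deckLaw.map fun w => (G.deckStep w)^[t] (G.initial A) := by
  have h := G.law_bind_deckLaw A t 0
  simp only [Function.iterate_zero, id_eq, Nat.add_zero] at h
  rw [← h]
  conv_lhs => rw [← PMF.bind_pure (G.law A t)]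
  congr 1
  funext s
  exact (PMF.map_const _ _).symm

end Decks

/-! ### Priorities and tie-breaking. -/

section Strongest

variable {V : Type*} {k : ℕ}

theorem Game.strongest_eq_none (G : Game V k) {C : Finset (Cascade k)} :
    G.strongest C = none ↔ C = ∅ := by
  simp [Game.strongest, List.argmax_eq_none]

theorem Game.mem_of_strongest (G : Game V k) {C : Finset (Cascade k)} {c : Cascade k}
    (h : G.strongest C = some c) : c ∈ C :=
  Finset.mem_toList.1 (List.argmax_mem h)

theorem Game.strongest_eq_rumor (G : Game V k) {C : Finset (Cascade k)} (h : none ∈ C) :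
    G.strongest C = some none := by
  cases hc : G.strongest C with
  | none => rw [G.strongest_eq_none] at hc; simp [hc] at h
  | some c =>
    cases c with
    | none => rfl
    | some i =>
      have := List.le_of_mem_argmax (Finset.mem_toList.2 h) hc
      exact absurd (G.rumor_highest i) (not_lt.2 this)

end Strongest

/-! ### Fixed deck: activation times as reachability. -/

section Deterministic

variable {V : Type*} [Fintype V] [DecidableEq V] {k : ℕ}

/-- The nodes that `u` has tried `j` steps after its activation. -/
def Network.triedAfter (N : Network V) (w : Deck V) (u : V) : ℕ → Finset V
  | 0 => ∅
  | j + 1 => match N.entry w u (N.triedAfter w u j) with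
    | some (v, _) => insert v (N.triedAfter w u j)
    | none => N.triedAfter w u j

/-- The attempt that `u` makes in step `j + 1` after its activation is a success at `v`. -/
def Network.Hits (N : Network V) (w : Deck V) (u : V) (j : ℕ) (v : V) : Prop :=
  N.entry w u (N.triedAfter w u j) = some (v, true)

/-- `ReachesIn w x n v`: an activation of `x` can propagate to `v` in exactly `n` steps. -/
inductive Network.ReachesIn (N : Network V) (w : Deck V) (x : V) : ℕ → V → Prop
  | refl : N.ReachesIn w x 0 x
  | step {n j : ℕ} {u v : V} :
      N.ReachesIn w x n u → N.Hits w u j v → N.ReachesIn w x (n + j + 1) v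

/-- A node is reached from the rumor in `n` steps. -/
def Game.RumorReaches (G : Game V k) (w : Deck V) (n : ℕ) (v : V) : Prop :=
  ∃ x ∈ G.rumorSeeds, G.ReachesIn w x n v

/-- A node is reached from some seed in `n` steps. -/
def Game.Reaches (G : Game V k) (w : Deck V) (A : Fin k → Finset V) (n : ℕ) (v : V) : Prop :=
  ∃ c, ∃ x ∈ G.seeds A c, G.ReachesIn w x n v

/-- What is known about the node `v` at time `t` when it is in the state `o` and has tried the
nodes in `T`. -/
def Game.Describes (G : Game V k) (w : Deck V) (A : Fin k → Finset V) (t : ℕ) (v : V)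
    (T : Finset V) : Option (Cascade k) → Prop
  | none => T = ∅ ∧ ∀ n ≤ t, ¬ G.Reaches w A n v
  | some c => ∃ a ≤ t, G.Reaches w A a v ∧ (∀ m < a, ¬ G.Reaches w A m v) ∧
      T = G.triedAfter w v (t - a) ∧ (c = none ↔ G.RumorReaches w a v)

theorem Network.reachesIn_zero (N : Network V) (w : Deck V) {x v : V}
    (h : N.ReachesIn w x 0 v) : x = v := by
  cases h; rfl

theorem Game.describes_initial (G : Game V k) (w : Deck V) (A : Fin k → Finset V) (v : V) :
    G.Describes w A 0 v ((G.initial A).2 v) ((G.initial A).1 v) := by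
  cases h : (G.initial A).1 v with
  | none =>
    refine ⟨rfl, fun n hn => ?_⟩
    obtain rfl : n = 0 := by omega
    rintro ⟨c, x, hx, hr⟩
    obtain rfl := G.reachesIn_zero w hr
    have := G.strongest_eq_none.1 h
    have hc : c ∈ (∅ : Finset (Cascade k)) := by rw [← this]; simpa using hx
    simp at hc
  | some c =>
    have hc : v ∈ G.seeds A c := by simpa using G.mem_of_strongest h
    refine ⟨0, le_rfl, ⟨c, v, hc, .refl⟩, by simp, rfl, ?_⟩
    constructor
    · rintro rfl
      exact ⟨v, hc, .refl⟩
    · rintro ⟨x, hx, hr⟩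
      obtain rfl := G.reachesIn_zero w hr
      have h' := G.strongest_eq_rumor
        (C := Finset.univ.filter fun c => x ∈ G.seeds A c) (Finset.mem_filter.2 ⟨Finset.mem_univ _, hx⟩)
      exact Option.some_injective _ (h.symm.trans h')

/-- The attempts of an active node are determined by the deck and its age, so first arrivals
propagate with fixed delays whatever the cascade. -/
theorem Game.describes_deckStep (G : Game V k) (w : Deck V) (A : Fin k → Finset V) (t : ℕ)
    (s : State V k) (hs : ∀ v, G.Describes w A t v (s.2 v) (s.1 v)) (v : V) :
    G.Describes w A (t + 1) v ((G.deckStep w s).2 v) ((G.deckStep w s).1 v) := by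
  have hdraw : ∀ u c a, s.1 u = some c → s.2 u = G.triedAfter w u (t - a) →
      ∀ v, G.draw w s u = some (v, true) ↔ G.Hits w u (t - a) v := by
    intro u c a hc ha v
    simp [Network.draw, hc, ha, Network.Hits]
  cases hv : s.1 v with
  | some c =>
    have h := hs v
    rw [hv] at h
    obtain ⟨a, hat, hr, hmin, hT, hc⟩ := h
    have h1 : (G.deckStep w s).1 v = some c := by simp [Game.deckStep, Game.update, hv]
    rw [h1]
    refine ⟨a, by omega, hr, hmin, ?_, hc⟩
    rw [show t + 1 - a = (t - a) + 1 by omega]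
    simp only [Game.deckStep, Game.update, Network.draw, hv, Network.triedAfter, hT, ne_eq,
      reduceCtorEq, not_false_eq_true, if_true]
  | none =>
    have h := hs v
    rw [hv] at h
    obtain ⟨hT, hno⟩ := h
    have h2 : (G.deckStep w s).2 v = ∅ := by
      simp [Game.deckStep, Game.update, Network.draw, hv, hT]
    have h1 : (G.deckStep w s).1 v = G.strongest
        (Finset.univ.filter fun c => ∃ u, s.1 u = some c ∧ G.draw w s u = some (v, true)) := by
      simp [Game.deckStep, Game.update, hv]
    -- A path arriving at `v` at time `t + 1` must reach its last node `u` exactly when `u` is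
    -- activated: an earlier activation of `u` would make `v` reached by time `t`.
    have hlast : ∀ c x, x ∈ G.seeds A c → G.ReachesIn w x (t + 1) v →
        ∃ u c' a, s.1 u = some c' ∧ G.draw w s u = some (v, true) ∧ G.ReachesIn w x a u ∧
          (c' = none ↔ G.RumorReaches w a u) := by
      intro c x hx hr
      generalize hm : t + 1 = m at hr
      cases hr with
      | refl => omega
      | @step n j u v hn hj =>
        have hu := hs u
        cases hc : s.1 u with
        | none =>
          rw [hc] at hu
          exact absurd ⟨c, x, hx, hn⟩ (hu.2 n (by omega))
        | some c' =>
          rw [hc] at hu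
          obtain ⟨a, hat, ⟨c₂, y, hy, hya⟩, hmin, hT, hiff⟩ := hu
          have han : a = n := by
            rcases lt_trichotomy a n with hlt | heq | hgt
            · exact absurd ⟨c₂, y, hy, .step hya hj⟩ (hno (a + j + 1) (by omega))
            · exact heq
            · exact absurd ⟨c, x, hx, hn⟩ (hmin n hgt)
          subst han
          refine ⟨u, c', a, hc, (hdraw u c' a hc hT v).2 ?_, hn, hiff⟩
          rwa [show t - a = j by omega]
    rw [h2]
    cases h3 : (G.deckStep w s).1 v with
    | none =>
      refine ⟨rfl, fun n hn => ?_⟩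
      rcases Nat.lt_or_ge t n with hlt | hge
      · obtain rfl : n = t + 1 := by omega
        rintro ⟨c, x, hx, hr⟩
        obtain ⟨u, c', a, hc, hd, -, -⟩ := hlast c x hx hr
        have h4 := G.strongest_eq_none.1 (h1.symm.trans h3)
        have : c' ∈ (∅ : Finset (Cascade k)) := by rw [← h4]; simpa using ⟨u, hc, hd⟩
        simp at this
      · exact hno n hge
    | some c =>
      have h4 := G.mem_of_strongest (h1.symm.trans h3)
      simp only [Finset.mem_filter, Finset.mem_univ, true_and] at h4
      obtain ⟨u, hc, hd⟩ := h4
      have hu := hs u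
      rw [hc] at hu
      obtain ⟨a, hat, ⟨c₂, y, hy, hya⟩, hmin, hT', hiff⟩ := hu
      have hhit := (hdraw u c a hc hT' v).1 hd
      have hstep : ∀ x, G.ReachesIn w x a u → G.ReachesIn w x (t + 1) v := by
        intro x hx
        have := Network.ReachesIn.step hx hhit
        rwa [show a + (t - a) + 1 = t + 1 by omega] at this
      refine ⟨t + 1, le_rfl, ⟨c₂, y, hy, hstep y hya⟩, fun m hm => hno m (by omega), ?_, ?_⟩
      · simp [Network.triedAfter]
      · constructor
        · intro hcn
          obtain ⟨x, hx, hr⟩ := hiff.1 hcn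
          exact ⟨x, hx, hstep x hr⟩
        -- The last node of a rumor path carries the rumor, which is then among the competing
        -- cascades and wins the tie.
        · rintro ⟨x, hx, hr⟩
          obtain ⟨u', c', b, hc', hd', hb, hiff'⟩ := hlast none x hx hr
          obtain rfl := hiff'.2 ⟨x, hx, hb⟩
          have h5 := G.strongest_eq_rumor (C := Finset.univ.filter fun c =>
            ∃ u, s.1 u = some c ∧ G.draw w s u = some (v, true)) (by simpa using ⟨u', hc', hd'⟩)
          exact Option.some_injective _ ((h1.symm.trans h3).symm.trans h5)

theorem Game.describes_iterate (G : Game V k) (w : Deck V) (A : Fin k → Finset V) (t : ℕ) :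
    ∀ v, G.Describes w A t v (((G.deckStep w)^[t] (G.initial A)).2 v)
      (((G.deckStep w)^[t] (G.initial A)).1 v) := by
  induction t with
  | zero => exact G.describes_initial w A
  | succ t ih =>
    rw [Function.iterate_succ_apply']
    exact G.describes_deckStep w A t _ ih

/-- A node is activated by the rumor until time `t` if and only if the rumor reaches it until then
and no positive seed reaches it earlier. -/
theorem Game.iterate_eq_rumor_iff (G : Game V k) (w : Deck V) (A : Fin k → Finset V) (t : ℕ)
    (v : V) : ((G.deckStep w)^[t] (G.initial A)).1 v = some none ↔
      ∃ n ≤ t, G.RumorReaches w n v ∧ ∀ m < n, ∀ i, ∀ x ∈ A i, ¬ G.ReachesIn w x m v := by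
  have h := G.describes_iterate w A t v
  constructor
  · intro hv
    rw [hv] at h
    obtain ⟨a, hat, -, hmin, -, hc⟩ := h
    exact ⟨a, hat, hc.1 rfl, fun m hm i x hx hr => hmin m hm ⟨some i, x, hx, hr⟩⟩
  · rintro ⟨n, hnt, ⟨x, hx, hr⟩, hno⟩
    cases hv : ((G.deckStep w)^[t] (G.initial A)).1 v with
    | none =>
      rw [hv] at h
      exact absurd ⟨none, x, hx, hr⟩ (h.2 n hnt)
    | some c =>
      rw [hv] at h
      obtain ⟨a, hat, ⟨c', y, hy, hya⟩, hmin, -, hc⟩ := h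
      rw [hc.2]
      cases c' with
      | none => exact ⟨y, hy, hya⟩
      | some i =>
        rcases lt_trichotomy a n with hlt | heq | hgt
        · exact absurd hya (hno a hlt i y hy)
        · exact heq ▸ ⟨x, hx, hr⟩
        · exact absurd ⟨none, x, hx, hr⟩ (hmin n hgt)

/-- For a fixed deck, a node is saved from the rumor by a set of seeds if and only if the set
meets a fixed set of nodes, or the node is saved without any seed. -/
theorem Game.exists_coverage (G : Game V k) (w : Deck V) (t : ℕ) (v : V) :
    ∃ (b : Prop) (Y : Set V), ∀ A : Fin k → Finset V,
      ((G.deckStep w)^[t] (G.initial A)).1 v ≠ some none ↔ b ∨ ∃ i, ∃ x ∈ A i, x ∈ Y := by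
  classical
  by_cases h : ∃ n, n ≤ t ∧ G.RumorReaches w n v
  -- `Nat.find h` is the first arrival of the rumor, independent of `A`; the inequality is strict
  -- because ties go to the rumor.
  · refine ⟨False, {x | ∃ m < Nat.find h, G.ReachesIn w x m v}, fun A => ?_⟩
    rw [Ne, G.iterate_eq_rumor_iff, false_or]
    constructor
    · intro hn
      by_contra hc
      refine hn ⟨Nat.find h, (Nat.find_spec h).1, (Nat.find_spec h).2, ?_⟩
      exact fun m hm i x hx hr => hc ⟨i, x, hx, m, hm, hr⟩
    · rintro ⟨i, x, hx, m, hm, hr⟩ ⟨n, hnt, hn, hno⟩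
      exact hno m (hm.trans_le (Nat.find_min' h ⟨hnt, hn⟩)) i x hx hr
  · refine ⟨True, ∅, fun A => ?_⟩
    rw [Ne, G.iterate_eq_rumor_iff]
    simp only [true_or, iff_true]
    rintro ⟨n, hnt, hn, -⟩
    exact h ⟨n, hnt, hn⟩

end Deterministic

/-! ### Inequalities for coverage functions. -/

section Coverage

variable {V : Type*} {k : ℕ}

open Classical in
/-- The increments of a coverage function along deviations of single agents. -/
theorem coverage_increment (b : Prop) (Y : Set V) (A B : Fin k → Finset V)
    (c : (Fin k → Finset V) → ℝ)
    (hc : ∀ A, c A = if b ∨ ∃ i, ∃ x ∈ A i, x ∈ Y then 1 else 0) :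
    c B + ∑ i, c (Function.update A i ∅) ≤ c A + ∑ i, c (Function.update A i (B i)) := by
  have h0 : ∀ A, 0 ≤ c A := fun A => by rw [hc]; split_ifs <;> norm_num
  have h1 : ∀ A, c A ≤ 1 := fun A => by rw [hc]; split_ifs <;> norm_num
  have hle : ∀ i, c (Function.update A i ∅) ≤ c (Function.update A i (B i)) := by
    intro i
    rw [hc, hc]
    split_ifs with h2 h3 <;> try norm_num
    refine h3 (h2.imp_right ?_)
    rintro ⟨j, x, hx, hY⟩
    have hj : j ≠ i := by rintro rfl; simp at hx
    exact ⟨j, x, by simpa [hj] using hx, hY⟩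
  -- If `A` covers, then `c A = 1` dominates `c B`, and the sums compare term by term.
  by_cases hA : b ∨ ∃ i, ∃ x ∈ A i, x ∈ Y
  · have : c A = 1 := by rw [hc, if_pos hA]
    have := Finset.sum_le_sum fun i (_ : i ∈ Finset.univ) => hle i
    linarith [h1 B]
  by_cases hB : b ∨ ∃ i, ∃ x ∈ B i, x ∈ Y
  -- An agent `i` whose part of `B` meets `Y` gains the full unit by deviating alone, which pays for
  -- `c B`.
  · obtain ⟨i, x, hx, hY⟩ := hB.resolve_left fun hb => hA (Or.inl hb)
    have hi0 : c (Function.update A i ∅) = 0 := by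
      rw [hc, if_neg]
      rintro (hb | ⟨j, y, hy, hyY⟩)
      · exact hA (Or.inl hb)
      · have hj : j ≠ i := by rintro rfl; simp at hy
        exact hA (Or.inr ⟨j, y, by simpa [hj] using hy, hyY⟩)
    have hi1 : c (Function.update A i (B i)) = 1 := by
      rw [hc, if_pos]
      exact Or.inr ⟨i, x, by simpa using hx, hY⟩
    rw [← Finset.add_sum_erase _ _ (Finset.mem_univ i),
      ← Finset.add_sum_erase (a := i) _ (fun i => c (Function.update A i (B i)))
        (Finset.mem_univ i), hi0, hi1]
    have := Finset.sum_le_sum fun j (_ : j ∈ Finset.univ.erase i) => hle j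
    linarith [h1 B, h0 A]
  · have : c B = 0 := by rw [hc, if_neg hB]
    have := Finset.sum_le_sum fun i (_ : i ∈ Finset.univ) => hle i
    linarith [h0 A]

open Classical in
/-- The contributions of the agents to a coverage function sum up to at most its value. -/
theorem coverage_contribution (b : Prop) (Y : Set V) (A : Fin k → Finset V)
    (c : (Fin k → Finset V) → ℝ)
    (hc : ∀ A, c A = if b ∨ ∃ i, ∃ x ∈ A i, x ∈ Y then 1 else 0) :
    ∑ _i : Fin k, c A ≤ c A + ∑ i, c (Function.update A i ∅) := by
  have h0 : ∀ A, 0 ≤ c A := fun A => by rw [hc]; split_ifs <;> norm_num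
  by_cases hA : b ∨ ∃ i, ∃ x ∈ A i, x ∈ Y
  · have h1 : c A = 1 := by rw [hc, if_pos hA]
    rcases hA with hb | ⟨i, x, hx, hY⟩
    · have h2 : ∀ A, c A = 1 := fun A => by rw [hc, if_pos (Or.inl hb)]
      simp [h2]
    · rw [← Finset.add_sum_erase _ _ (Finset.mem_univ i),
        ← Finset.add_sum_erase _ (fun i => c (Function.update A i ∅)) (Finset.mem_univ i)]
      -- Removing any agent other than `i` leaves the witness `x` in place, so only agent `i` can be
      -- pivotal.
      have : ∑ j ∈ Finset.univ.erase i, c A ≤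
          ∑ j ∈ Finset.univ.erase i, c (Function.update A j ∅) := by
        refine Finset.sum_le_sum fun j hj => ?_
        rw [h1, hc, if_pos]
        exact Or.inr ⟨i, x, by simpa [(Finset.ne_of_mem_erase hj).symm] using hx, hY⟩
      linarith [h0 (Function.update A i ∅)]
  · have h1 : c A = 0 := by rw [hc, if_neg hA]
    rw [h1]
    simpa using Finset.sum_nonneg fun i _ => h0 _

end Coverage

/-! ### From coverage to expected utilities. -/

section Utility

variable {V : Type*} [Fintype V] [DecidableEq V] {k : ℕ}

/-- The number of nodes that are saved from the rumor for a fixed deck. -/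
def Game.saved (G : Game V k) (w : Deck V) (A : Fin k → Finset V) : ℝ :=
  notRumorCount ((G.deckStep w)^[G.edges.card] (G.initial A))

theorem Game.gamma_eq_expect (G : Game V k) (A : Fin k → Finset V) :
    G.gamma A = expect G.deckLaw fun w => G.saved w A := by
  rw [Game.gamma, G.law_eq_map_deckLaw]
  exact expect_map G.deckLaw (fun w => (G.deckStep w)^[G.edges.card] (G.initial A))
    fun s => (notRumorCount s : ℝ)

theorem Game.saved_eq_sum (G : Game V k) (w : Deck V) (A : Fin k → Finset V) :
    G.saved w A = ∑ v, if ((G.deckStep w)^[G.edges.card] (G.initial A)).1 v ≠ some none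
      then (1 : ℝ) else 0 := by
  rw [Finset.sum_boole]
  rfl

/-- The coverage inequality holds for each deck and node. Written without subtraction, it passes to
sums and expectations term by term. -/
theorem Game.gamma_increment (G : Game V k) (A B : Fin k → Finset V) :
    G.gamma B + ∑ i, G.gamma (Function.update A i ∅) ≤
      G.gamma A + ∑ i, G.gamma (Function.update A i (B i)) := by
  simp only [G.gamma_eq_expect, ← expect_sum, ← expect_add]
  refine expect_mono _ fun w => ?_
  simp only [G.saved_eq_sum]
  rw [Finset.sum_comm, Finset.sum_comm (s := Finset.univ (α := Fin k)), ← Finset.sum_add_distrib,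
    ← Finset.sum_add_distrib]
  refine Finset.sum_le_sum fun v _ => ?_
  classical
  obtain ⟨b, Y, h⟩ := G.exists_coverage w G.edges.card v
  exact coverage_increment b Y A B
    (fun A => if ((G.deckStep w)^[G.edges.card] (G.initial A)).1 v ≠ some none then 1 else 0)
    fun A => if_congr (h A) rfl rfl

theorem Game.gamma_contribution (G : Game V k) (A : Fin k → Finset V) :
    ∑ _i : Fin k, G.gamma A ≤ G.gamma A + ∑ i, G.gamma (Function.update A i ∅) := by
  simp only [G.gamma_eq_expect, ← expect_sum, ← expect_add]
  refine expect_mono _ fun w => ?_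
  simp only [G.saved_eq_sum]
  rw [Finset.sum_comm, Finset.sum_comm (s := Finset.univ (α := Fin k)), ← Finset.sum_add_distrib]
  refine Finset.sum_le_sum fun v _ => ?_
  classical
  obtain ⟨b, Y, h⟩ := G.exists_coverage w G.edges.card v
  exact coverage_contribution b Y A
    (fun A => if ((G.deckStep w)^[G.edges.card] (G.initial A)).1 v ≠ some none then 1 else 0)
    fun A => if_congr (h A) rfl rfl

theorem Game.socialUtility_eq_expect (G : Game V k) (S : Fin k → PMF (Finset V)) :
    G.socialUtility S = expect (independent S) G.gamma := rfl

theorem Game.socialUtility_update (G : Game V k) (S T : Fin k → PMF (Finset V)) (i : Fin k) :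
    G.socialUtility (Function.update S i (T i)) =
      expect (independent S) fun A => expect (independent T) fun B =>
        G.gamma (Function.update A i (B i)) := by
  rw [Game.socialUtility_eq_expect, ← map_update_independent, expect_bind]
  simp only [expect_map]

theorem Game.socialUtility_update_empty (G : Game V k) (S : Fin k → PMF (Finset V)) (i : Fin k) :
    G.socialUtility (Function.update S i emptyStrategy) =
      expect (independent S) fun A => G.gamma (Function.update A i ∅) := by
  have h := G.socialUtility_update S (fun _ => emptyStrategy) i
  simp only [emptyStrategy, independent_pure (fun _ : Fin k => (∅ : Finset V)), expect_pure] at h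
  exact h

/-- Average `Game.gamma_increment` over independent profiles `A` from `S` and `B` from `T`; each
hybrid profile then has the law of a unilateral deviation. -/
theorem Game.socialUtility_increment (G : Game V k) (S T : Fin k → PMF (Finset V)) :
    G.socialUtility T + ∑ i, G.socialUtility (Function.update S i emptyStrategy) ≤
      G.socialUtility S + ∑ i, G.socialUtility (Function.update S i (T i)) := by
  have h : expect (independent S) (fun A => expect (independent T) fun B =>
        G.gamma B + ∑ i, G.gamma (Function.update A i ∅)) ≤
      expect (independent S) fun A => expect (independent T) fun B =>
        G.gamma A + ∑ i, G.gamma (Function.update A i (B i)) :=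
    expect_mono _ fun A => expect_mono _ fun B => G.gamma_increment A B
  simp only [expect_add, expect_const, expect_sum] at h
  simpa only [G.socialUtility_update, G.socialUtility_update_empty,
    G.socialUtility_eq_expect] using h

theorem Game.socialUtility_contribution (G : Game V k) (S : Fin k → PMF (Finset V)) :
    ∑ _i : Fin k, G.socialUtility S ≤
      G.socialUtility S + ∑ i, G.socialUtility (Function.update S i emptyStrategy) := by
  have h := expect_mono (independent S) G.gamma_contribution
  simp only [expect_add, expect_sum] at h
  simpa only [G.socialUtility_update_empty, G.socialUtility_eq_expect] using h

/-- In a Nash equilibrium no agent can increase the social utility by a deviation. -/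
theorem Game.IsNashEquilibrium.socialUtility_update_le {G : Game V k} {S : Fin k → PMF (Finset V)}
    (hS : G.IsNashEquilibrium S) (i : Fin k) {s : PMF (Finset V)} (hs : G.IsStrategy i s) :
    G.socialUtility (Function.update S i s) ≤ G.socialUtility S := by
  have h := hS.2 i s hs
  simp only [Game.privateUtility, Function.update_idem] at h
  linarith

/-- A mixed utility is an average of `gamma` over admissible pure profiles, so a best pure profile
is optimal. The given full-strategy ensures that admissible profiles exist. -/
theorem Game.exists_isSociallyOptimal (G : Game V k) (S : Fin k → PMF (Finset V))
    (hS : G.IsFullStrategy S) : ∃ Ω, G.IsSociallyOptimal Ω := by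
  have hne : (Fintype.piFinset G.actions).Nonempty := by
    rw [Fintype.piFinset_nonempty]
    intro i
    obtain ⟨a, ha⟩ := (S i).support_nonempty
    exact ⟨a, hS i a ha⟩
  obtain ⟨A, hA, hmax⟩ := Finset.exists_max_image _ G.gamma hne
  refine ⟨fun i => PMF.pure (A i), fun i a ha => ?_, fun T hT => ?_⟩
  · rw [PMF.mem_support_pure_iff] at ha
    subst ha
    exact Fintype.mem_piFinset.1 hA i
  · rw [G.socialUtility_eq_expect, G.socialUtility_eq_expect, independent_pure, expect_pure,
      ← expect_const (independent T) (G.gamma A)]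
    refine expect_mono_support _ fun B hB => hmax B (Fintype.mem_piFinset.2 fun i => ?_)
    exact hT i _ (mem_support_independent _ hB i)

end Utility

end

end RumorBlocking

theorem corollary1 {V : Type*} [Fintype V] [DecidableEq V] {k : ℕ}
    (G : RumorBlocking.Game V k) (S : Fin k → PMF (Finset V))
    (hS : G.IsNashEquilibrium S) :
    (∃ Ω, G.IsSociallyOptimal Ω) ∧
      ∀ Ω, G.IsSociallyOptimal Ω → G.socialUtility S ≥ (1 / 2) * G.socialUtility Ω := by
  refine ⟨G.exists_isSociallyOptimal S hS.1, fun Ω hΩ => ?_⟩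
  have h1 := G.socialUtility_increment S Ω
  have h2 := G.socialUtility_contribution S
  have h3 := Finset.sum_le_sum fun i (_ : i ∈ Finset.univ) =>
    hS.socialUtility_update_le i (hΩ.1 i)
  -- The sums over abstaining agents in `h1` and `h2` cancel, and `h3` bounds the deviations.
  linarith
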